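/- Work over $\mathbb{C}$ and put $V=\mathbb{C}^{n+1}$. Let $X_1,\dots,X_k\subset\mathbb{P}^n=\mathbb{P}V$ be projective varieties (irreducible, Zariski closed). For $X\subset\mathbb{P}V$ let $\hat X\subset V\setminus\{0\}$ be its affine cone, i.e. its preimage under $V\setminus\{0\}\to\mathbb{P}V$, and for $x\in\hat X$ let $\hat T_{[x]}X\subset V$ be the affine tangent space, i.e. the Zariski tangent space at $x$ of the affine cone over $X$. The join $\mathbf{J}(X_1,\dots,X_k)$ is the Zariski closure of the union of the linear spans $\langle[P_1],\dots,[P_k]\rangle$ over all linearly independent $P_1,\dots,P_k$ with $P_i\in\hat X_i$. "General" means: in a suitable Zariski open dense subset. The join $\mathbf{J}(X_1,\dots,X_k)$ is called not tangentially weakly defective if for general $(P_1,\dots,P_k)\in\hat X_1\times\dots\times\hat X_k$ the following holds: for every $j\in\{1,\dots,k\}$ and every $Q_j\in\hat X_j$, if $\hat T_{[P_1]}X_1+\dots+\hat T_{[P_k]}X_k\supseteq\hat T_{[Q_j]}X_j$, then $[Q_j]\in\{[P_1],\dots,[P_k]\}$. Corollary. If $\mathbf{J}(X_1,\dots,X_k)$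 is not tangentially weakly defective, then a general point $[\varphi]\in\mathbf{J}(X_1,\dots,X_k)$ has a decomposition $[\varphi]=[P_1+\dots+P_k]$ with $[P_i]\in X_i$ for $1\le i\le k$, and this decomposition is essentially unique: if also $[\varphi]=[Q_1+\dots+Q_k]$ with $[Q_i]\in X_i$, then there are a permutation $\sigma$ of $\{1,\dots,k\}$ with $X_{\sigma(i)}=X_i$ for all $i$ and a constant $c\in\mathbb{C}^*$ such that $Q_i=c\,P_{\sigma(i)}$ for all $i$. -/

import Mathlib

open scoped LinearAlgebra.Projectivization Topology

noncomputable section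

namespace JoinDecomp

/-- The complex vector space `V = ℂ^{n+1}`. -/
abbrev Vec (n : ℕ) : Type := Fin (n + 1) → ℂ

/-- Complex projective space `ℙⁿ = ℙ V`. -/
abbrev PSpace (n : ℕ) : Type := ℙ ℂ (Vec n)

/-! ### Zariski topologies -/

/-- The zero locus in `ℂ^ι` of a set of polynomials. -/
def affineZeros {ι : Type} (S : Set (MvPolynomial ι ℂ)) : Set (ι → ℂ) :=
  {x | ∀ f ∈ S, MvPolynomial.eval x f = 0}

/-- The Zariski topology on the affine space `ℂ^ι`: the closed sets are the zero loci of sets of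
polynomials. -/
@[reducible] def affineZariski (ι : Type) : TopologicalSpace (ι → ℂ) :=
  TopologicalSpace.ofClosed {Z | ∃ S : Set (MvPolynomial ι ℂ), Z = affineZeros S}
    ⟨{1}, by ext x; simp [affineZeros]⟩
    (by
      intro A hA
      refine ⟨{f | ∃ Z ∈ A, ∀ x ∈ Z, MvPolynomial.eval x f = 0}, ?_⟩
      ext x
      constructor
      · rintro hx f ⟨Z, hZ, hf⟩
        exact hf x (hx Z hZ)
      · intro hx Z hZ
        obtain ⟨S, rfl⟩ := hA hZ
        exact fun f hf => hx f ⟨_, hZ, fun y hy => hy f hf⟩)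
    (by
      rintro _ ⟨S, rfl⟩ _ ⟨T, rfl⟩
      refine ⟨{h | ∃ f ∈ S, ∃ g ∈ T, h = f * g}, ?_⟩
      ext x
      constructor
      · rintro (hx | hx) _ ⟨f, hf, g, hg, rfl⟩
        · simp [hx f hf]
        · simp [hx g hg]
      · intro hx
        by_contra hcon
        simp only [Set.mem_union, not_or, affineZeros, Set.mem_ofPred_eq, not_forall] at hcon
        obtain ⟨⟨f, hf, hfx⟩, g, hg, hgx⟩ := hcon
        have := hx _ ⟨f, hf, g, hg, rfl⟩
        rw [map_mul] at this
        exact (mul_ne_zero hfx hgx) this)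

/-- The Zariski topology on `V^k`, which is the affine space of dimension `k (n + 1)`. -/
@[reducible] def tupleZariski (k n : ℕ) : TopologicalSpace (Fin k → Vec n) :=
  TopologicalSpace.induced (fun P (a : Fin k × Fin (n + 1)) => P a.1 a.2)
    (affineZariski (Fin k × Fin (n + 1)))

/-- The zero locus in `ℙⁿ` of a set of polynomials (used for homogeneous ones only, for which the
choice of the representative does not matter). -/
def projZeros {n : ℕ} (S : Set (MvPolynomial (Fin (n + 1)) ℂ)) : Set (PSpace n) :=
  {x | ∀ f ∈ S, MvPolynomial.eval x.rep f = 0}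

/-- The Zariski topology on `ℙⁿ`: the closed sets are the zero loci of sets of homogeneous
polynomials. -/
@[reducible] def projZariski (n : ℕ) : TopologicalSpace (PSpace n) :=
  TopologicalSpace.ofClosed
    {Z | ∃ S : Set (MvPolynomial (Fin (n + 1)) ℂ),
      (∀ f ∈ S, ∃ d, f.IsHomogeneous d) ∧ Z = projZeros S}
    ⟨{1}, by
      rintro f rfl
      exact ⟨0, MvPolynomial.isHomogeneous_one _ _⟩, by ext x; simp [projZeros]⟩
    (by
      intro A hA
      refine ⟨{f | (∃ d, f.IsHomogeneous d) ∧
        ∃ Z ∈ A, ∀ x ∈ Z, MvPolynomial.eval x.rep f = 0}, fun f hf => hf.1, ?_⟩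
      ext x
      constructor
      · rintro hx f ⟨_, Z, hZ, hf⟩
        exact hf x (hx Z hZ)
      · intro hx Z hZ
        obtain ⟨S, hS, rfl⟩ := hA hZ
        exact fun f hf => hx f ⟨hS f hf, _, hZ, fun y hy => hy f hf⟩)
    (by
      rintro _ ⟨S, hS, rfl⟩ _ ⟨T, hT, rfl⟩
      refine ⟨{h | ∃ f ∈ S, ∃ g ∈ T, h = f * g}, ?_, ?_⟩
      · rintro _ ⟨f, hf, g, hg, rfl⟩
        obtain ⟨d, hd⟩ := hS f hf
        obtain ⟨e, he⟩ := hT g hg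
        exact ⟨d + e, hd.mul he⟩
      ext x
      constructor
      · rintro (hx | hx) _ ⟨f, hf, g, hg, rfl⟩
        · simp [hx f hf]
        · simp [hx g hg]
      · intro hx
        by_contra hcon
        simp only [Set.mem_union, not_or, projZeros, Set.mem_ofPred_eq, not_forall] at hcon
        obtain ⟨⟨f, hf, hfx⟩, g, hg, hgx⟩ := hcon
        have := hx _ ⟨f, hf, g, hg, rfl⟩
        rw [map_mul] at this
        exact (mul_ne_zero hfx hgx) this)

/-- A property holds for a general point of `Y`: it holds on a subset of `Y` that is relatively
open and dense in `Y` (for the topology `t`, here always a Zariski topology). -/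
def HoldsGenerally {α : Type} (t : TopologicalSpace α) (Y : Set α) (p : α → Prop) : Prop :=
  ∃ U : Set α, IsOpen[t] U ∧ Y ⊆ closure[t] (Y ∩ U) ∧ ∀ y ∈ Y ∩ U, p y

/-! ### Projective varieties, cones, tangent spaces, joins -/

variable {n k : ℕ}

/-- Projective varieties: irreducible (in particular nonempty) Zariski closed subsets of `ℙⁿ`. -/
def IsProjectiveVariety (X : Set (PSpace n)) : Prop :=
  IsClosed[projZariski n] X ∧ @IsIrreducible _ (projZariski n) X

/-- The affine cone `X̂ ⊆ V`: the preimage of `X` under `V \ {0} → ℙ V`. -/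
def cone (X : Set (PSpace n)) : Set (Vec n) :=
  {v | ∃ hv : v ≠ 0, Projectivization.mk ℂ v hv ∈ X}

/-- The affine tangent space to `X` at `[x]`: the Zariski tangent space at `x` of the affine cone
over `X`, cut out by the differentials at `x` of all polynomials that vanish on the cone. -/
def affineTangent (X : Set (PSpace n)) (x : Vec n) : Submodule ℂ (Vec n) where
  carrier := {v | ∀ f ∈ MvPolynomial.vanishingIdeal ℂ (cone X),
    ∑ a, MvPolynomial.eval x (MvPolynomial.pderiv a f) * v a = 0}
  zero_mem' := by intro f _; simp
  add_mem' := by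
    intro v w hv hw f hf
    simp [mul_add, Finset.sum_add_distrib, hv f hf, hw f hf]
  smul_mem' := by
    intro c v hv f hf
    have h := hv f hf
    simp only [Pi.smul_apply, smul_eq_mul, mul_left_comm _ c, ← Finset.mul_sum, h, mul_zero]

/-- The set of all tuples `(P₁, …, P_k)` with `P_i` in the affine cone over `X_i`. -/
def coneTuples (X : Fin k → Set (PSpace n)) : Set (Fin k → Vec n) :=
  {P | ∀ i, P i ∈ cone (X i)}

/-- The join `J(X₁, …, X_k)`: the Zariski closure of the union of the spans `⟨[P₁], …, [P_k]⟩`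
over all linearly independent vectors `P₁, …, P_k` with `[P_i] ∈ X_i`. -/
def join (X : Fin k → Set (PSpace n)) : Set (PSpace n) :=
  closure[projZariski n] {x | ∃ P ∈ coneTuples X, LinearIndependent ℂ P ∧
    x.submodule ≤ Submodule.span ℂ (Set.range P)}

/-- The join is not tangentially weakly defective: for general `P_i` in the cone over `X_i`, if the
span of the tangent spaces at the `P_i` contains the tangent space of some `X_j` at some `[Q_j]`,
then `[Q_j]` is one of the `[P_i]` (nonzero vectors define the same point of `ℙⁿ` iff they differ
by a nonzero scalar). -/
def NotTangentiallyWeaklyDefective (X : Fin k → Set (PSpace n)) : Prop :=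
  HoldsGenerally (tupleZariski k n) (coneTuples X) fun P =>
    ∀ j : Fin k, ∀ Q ∈ cone (X j),
      affineTangent (X j) Q ≤ ⨆ i, affineTangent (X i) (P i) →
        ∃ i, ∃ c : ℂˣ, Q = c • P i

/-- `φ = [P₁ + ⋯ + P_k]` with `[P_i] ∈ X_i`. -/
def IsDecomposition (X : Fin k → Set (PSpace n)) (φ : PSpace n) (P : Fin k → Vec n) : Prop :=
  P ∈ coneTuples X ∧ ∃ h : ∑ i, P i ≠ 0, Projectivization.mk ℂ (∑ i, P i) h = φ

/-- `φ` has a decomposition, and it is unique up to the trivial identifications: permuting terms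
that belong to the same variety, and rescaling the whole sum. -/
def HasEssentiallyUniqueDecomposition (X : Fin k → Set (PSpace n)) (φ : PSpace n) : Prop :=
  (∃ P, IsDecomposition X φ P) ∧
    ∀ P Q, IsDecomposition X φ P → IsDecomposition X φ Q →
      ∃ σ : Equiv.Perm (Fin k), (∀ i, X (σ i) = X i) ∧ ∃ c : ℂˣ, ∀ i, Q i = c • P (σ i)

end JoinDecomp

end

/-! The product of the cones is irreducible, and if it contains a linearly independent tuple, its
image under the sum map is dense in the affine cone over the join, up to the origin; otherwise the
join is empty. The heart of the proof is Terracini's lemma (`exists_notMem_tupleIdeal_terracini`):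
by generic smoothness in characteristic zero, for general `P` the tangent space at `∑ i, P i` to the
closure of the image lies in the sum of the tangent spaces at the `P i`. In the other direction, at
every tuple `Q` the tangent space at `∑ i, Q i` contains the tangent space of each `X j` at `Q j`.

If `∑ i, Q i = ∑ i, P i` with `P` general, both inclusions hold at one point, and the absence of
tangential weak defects makes each `Q j` a multiple of some `P i`. Independence of the `P i` turns
this into `Q j = P (σ j)` for a permutation `σ`. A general `P i` lies over `X j` only if `X i ⊆ X
j`, so `X (σ j) ⊆ X j`, with equality because `σ` has finite order.

All this holds where one polynomial `b` does not vanish on the product. Chevalley's theorem carries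
that open set to one in the closure of the image, and a homogeneous component of its equation
defines the open set in `ℙⁿ`. -/

/-! ### Extension of derivations in characteristic zero -/

open KaehlerDifferential TensorProduct in
/-- Derivations into a formally smooth field extension extend to that field. -/
theorem Algebra.FormallySmooth.exists_derivation_extension {k A L : Type*} [CommRing k]
    [CommRing A] [Field L] [Algebra k A] [Algebra k L] [Algebra A L] [IsScalarTower k A L]
    [Algebra.FormallySmooth A L] (D : Derivation k A L) :
    ∃ D' : Derivation k L L, ∀ a, D' (algebraMap A L a) = D a := by
  -- The kernel is the image of the first cotangent homology of `L` over `A`, which vanishes by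
  -- formal smoothness. Over the field `L` an injective map has a left inverse.
  have hinj : Function.Injective (mapBaseChange k A L) := by
    rw [injective_iff_map_eq_zero]
    intro x hx
    obtain ⟨y, rfl⟩ := (Algebra.H1Cotangent.exact_δ_mapBaseChange k A L x).mp hx
    rw [Subsingleton.elim y 0, map_zero]
  obtain ⟨r, hr⟩ := (mapBaseChange k A L).exists_leftInverse_of_injective
    (LinearMap.ker_eq_bot.mpr hinj)
  let e : L ⊗[A] Ω[A⁄k] →ₗ[L] L := LinearMap.liftBaseChange L D.liftKaehlerDifferential
  refine ⟨(e.comp r).compDer (KaehlerDifferential.D k L), fun a => ?_⟩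
  have h1 : KaehlerDifferential.D k L (algebraMap A L a) =
      mapBaseChange k A L (1 ⊗ₜ KaehlerDifferential.D k A a) := by
    simp
  have h2 := LinearMap.congr_fun hr (1 ⊗ₜ KaehlerDifferential.D k A a)
  simp only [LinearMap.comp_apply, LinearMap.id_apply] at h2
  change e (r (KaehlerDifferential.D k L (algebraMap A L a))) = D a
  rw [h1, h2]
  simp [e]

/-- `L` is a finitely generated, hence separable, extension of `Frac A`, and `Frac A` is a
localization of `A`; both steps are formally smooth. -/
theorem Algebra.FormallySmooth.of_isFractionRing_of_charZero {k A L : Type*} (B : Type*) [Field k]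
    [CharZero k] [CommRing A] [CommRing B] [Field L] [Algebra k A] [Algebra k B] [Algebra k L]
    [Algebra A L] [Algebra B L] [IsScalarTower k A L] [IsScalarTower k B L] [FaithfulSMul A L]
    [IsFractionRing B L] [Algebra.FiniteType k B] : Algebra.FormallySmooth A L := by
  have := IsDomain.of_faithfulSMul A L
  have : Algebra.EssFiniteType k L := by
    have := Algebra.EssFiniteType.of_isLocalization L (nonZeroDivisors B)
    exact Algebra.EssFiniteType.comp k B L
  let := FractionRing.liftAlgebra A L
  have : Algebra.EssFiniteType (FractionRing A) L := Algebra.EssFiniteType.of_comp k _ _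
  have : CharZero (FractionRing A) :=
    charZero_of_injective_algebraMap (algebraMap k (FractionRing A)).injective
  have : Algebra.FormallySmooth A (FractionRing A) :=
    .of_isLocalization (nonZeroDivisors A)
  exact .comp A (FractionRing A) L

/-- In characteristic zero, a derivation of an algebra `S` with values in a finitely generated
field `L` over `S` extends to `L` as soon as it kills the kernel of `S → L`. -/
theorem Derivation.exists_extension_of_isFractionRing {k S L : Type*} (B : Type*) [Field k]
    [CharZero k] [CommRing S] [CommRing B] [Field L] [Algebra k S] [Algebra k B] [Algebra k L]
    [Algebra S L] [Algebra B L] [IsScalarTower k S L] [IsScalarTower k B L]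
    [IsFractionRing B L] [Algebra.FiniteType k B] (D : Derivation k S L)
    (hD : ∀ s, algebraMap S L s = 0 → D s = 0) :
    ∃ D' : Derivation k L L, ∀ s, D' (algebraMap S L s) = D s := by
  let f : S →ₐ[k] L := IsScalarTower.toAlgHom k S L
  -- By `hD` the derivation descends to the image of `S` in `L`, which embeds in `L`.
  have : Algebra.FormallySmooth f.range L := .of_isFractionRing_of_charZero (k := k) B
  have hex : ∀ a : f.range, ∃ s, f s = a := fun a => a.2
  choose i hi using hex
  have hDi : ∀ (s : S) (a : f.range), f s = a → D (i a) = D s := fun s a h => by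
    rw [← sub_eq_zero, ← map_sub]
    refine hD _ ?_
    have := (hi a).trans h.symm
    rwa [← sub_eq_zero, ← map_sub] at this
  let DA : Derivation k f.range L := Derivation.mk'
    { toFun := fun a => D (i a)
      map_add' := fun a b => by
        rw [← map_add]
        exact hDi _ _ (by simp [hi])
      map_smul' := fun c a => by
        rw [RingHom.id_apply, ← D.map_smul]
        exact hDi _ _ (by simp [hi]) }
    (fun a b => by
      change D (i (a * b)) = a • D (i b) + b • D (i a)
      rw [hDi (i a * i b) (a * b) (by simp [hi]), D.leibniz, Algebra.smul_def, Algebra.smul_def]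
      change f (i a) * _ + f (i b) * _ = _
      rw [hi, hi]
      rfl)
  obtain ⟨D', h⟩ := Algebra.FormallySmooth.exists_derivation_extension DA
  exact ⟨D', fun s => (h ⟨f s, s, rfl⟩).trans (hDi _ _ rfl)⟩

/-! ### Chevalley's theorem on closed points -/

/-- If `p` lies in the image of a constructible set under a morphism of finite presentation, then so
do all points of a nonempty open subset of the closure of `p`. -/
theorem PrimeSpectrum.exists_basicOpen_subset_comap_image {R S : Type*} [CommRing R] [CommRing S]
    {f : R →+* S} (hf : f.FinitePresentation) {s : Set (PrimeSpectrum S)}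
    (hs : Topology.IsConstructible s) {p : PrimeSpectrum R} (hp : p ∈ comap f '' s) :
    ∃ a ∉ p.asIdeal, ∀ q : PrimeSpectrum R, p.asIdeal ≤ q.asIdeal → a ∉ q.asIdeal →
      q ∈ comap f '' s := by
  obtain ⟨T, hT⟩ := exists_constructibleSetData_iff.mpr (isConstructible_comap_image hf hs)
  rw [← hT] at hp ⊢
  simp only [ConstructibleSetData.toSet, Set.mem_iUnion] at hp ⊢
  -- The constructible image is a finite union of sets `V(I) \ V(f)`; the piece containing `p`
  -- contains every larger prime that avoids its `f`.
  obtain ⟨C, hC, hpC⟩ := hp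
  simp only [BasicConstructibleSetData.toSet, Set.mem_sdiff, mem_zeroLocus,
    Set.singleton_subset_iff, SetLike.mem_coe] at hpC ⊢
  exact ⟨C.f, hpC.2, fun q hpq hq => ⟨C, hC, hpC.1.trans hpq, hq⟩⟩

namespace MvPolynomial

variable {σ τ : Type} [Finite σ] [Finite τ]

/-- The image of a nonempty open subset of an irreducible affine variety contains a nonempty open
subset of the closure of the image. -/
theorem exists_eval_ne_zero_imp_exists_preimage {K : Type} [Field K] [IsAlgClosed K]
    (p : Ideal (MvPolynomial σ K)) [p.IsPrime]
    (g : τ → MvPolynomial σ K) {b : MvPolynomial σ K} (hb : b ∉ p) :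
    ∃ a : MvPolynomial τ K, aeval g a ∉ p ∧ ∀ w : τ → K, (∀ f, aeval g f ∈ p → eval w f = 0) →
      eval w a ≠ 0 → ∃ x : σ → K, (∀ f ∈ p, eval x f = 0) ∧ eval x b ≠ 0 ∧
        ∀ t, eval x (g t) = w t := by
  let φ : MvPolynomial τ K →+* MvPolynomial σ K := (aeval g : _ →ₐ[K] _)
  have hφ : φ.FinitePresentation := by
    refine RingHom.FinitePresentation.of_finiteType.mp ?_
    refine RingHom.FiniteType.of_comp_finiteType (f := (C : K →+* _)) ?_
    have : φ.comp C = C := by ext; simp [φ]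
    rw [this]
    exact RingHom.finiteType_algebraMap.mpr inferInstance
  let s : Set (PrimeSpectrum (MvPolynomial σ K)) :=
    PrimeSpectrum.basicOpen b ∩ PrimeSpectrum.zeroLocus p
  have hs : Topology.IsConstructible s := by
    refine PrimeSpectrum.isConstructible_basicOpen.inter ?_
    rw [← Topology.isConstructible_compl]
    exact (PrimeSpectrum.isRetrocompact_zeroLocus_compl_of_fg
      (Ideal.fg_of_isNoetherianRing p)).isConstructible (PrimeSpectrum.isClosed_zeroLocus _).isOpen_compl
  obtain ⟨a, ha, h⟩ := PrimeSpectrum.exists_basicOpen_subset_comap_image hφ hs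
    (Set.mem_image_of_mem _ (show (⟨p, inferInstance⟩ : PrimeSpectrum _) ∈ s from ⟨hb, fun _ h => h⟩))
  refine ⟨a, ha, fun w hw hwa => ?_⟩
  obtain ⟨q, ⟨hqb, hqp⟩, hq⟩ := h (pointToPoint w)
    (fun f hf => by simpa [pointToPoint, aeval_eq_eval] using hw f hf)
    (by simpa [pointToPoint, aeval_eq_eval] using hwa)
  have hbq : b ∉ q.asIdeal := hqb
  -- Nullstellensatz: the prime `q` over `w` need not be maximal, but `V(q)` has a point where `b`
  -- does not vanish.
  rw [← IsPrime.vanishingIdeal_zeroLocus (K := K) q.asIdeal, mem_vanishingIdeal_iff] at hbq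
  push Not at hbq
  obtain ⟨x, hx, hbx⟩ := hbq
  refine ⟨x, fun f hf => by simpa [aeval_eq_eval] using hx f (hqp hf),
    by simpa [aeval_eq_eval] using hbx, fun t => ?_⟩
  have hX : X t - C (w t) ∈ (PrimeSpectrum.comap φ q).asIdeal := by
    rw [hq]
    simp [pointToPoint]
  have := hx _ hX
  rw [← sub_eq_zero]
  simpa [φ, aeval_eq_eval] using this

end MvPolynomial

/-! ### Generic smoothness -/

namespace MvPolynomial

theorem derivation_apply_eq_sum {σ R M : Type*} [Fintype σ] [CommRing R] [AddCommGroup M]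
    [Module R M] [Module (MvPolynomial σ R) M] [IsScalarTower R (MvPolynomial σ R) M]
    (D : Derivation R (MvPolynomial σ R) M) (f : MvPolynomial σ R) :
    D f = ∑ s, pderiv s f • D (X s) := by
  classical
  let D' : Derivation R (MvPolynomial σ R) M :=
    ∑ s, (LinearMap.toSpanSingleton (MvPolynomial σ R) M (D (X s))).compDer (pderiv s)
  have hD' : ∀ f, D' f = ∑ s, pderiv s f • D (X s) := fun f => by
    change Derivation.coeFnAddMonoidHom D' f = _
    rw [map_sum, Finset.sum_apply]
    rfl
  rw [← hD']
  congr 1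
  refine derivation_ext fun i => ?_
  rw [hD', Finset.sum_eq_single i]
  · simp
  · intro j _ hj
    simp [pderiv_X_of_ne hj.symm]
  · simp

variable {σ τ : Type} {K : Type} [Field K]

/-- The canonical map from polynomials to the function field of an irreducible affine variety. -/
noncomputable def toFunctionField (p : Ideal (MvPolynomial σ K)) [p.IsPrime] :
    MvPolynomial σ K →ₐ[K] FractionRing (MvPolynomial σ K ⧸ p) :=
  IsScalarTower.toAlgHom K _ _

theorem toFunctionField_apply (p : Ideal (MvPolynomial σ K)) [p.IsPrime] (f : MvPolynomial σ K) :
    toFunctionField p f = algebraMap (MvPolynomial σ K ⧸ p) _ (Ideal.Quotient.mk p f) :=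
  IsScalarTower.algebraMap_apply _ (MvPolynomial σ K ⧸ p) _ f

theorem toFunctionField_eq_zero_iff (p : Ideal (MvPolynomial σ K)) [p.IsPrime]
    {f : MvPolynomial σ K} : toFunctionField p f = 0 ↔ f ∈ p := by
  rw [toFunctionField_apply, FaithfulSMul.algebraMap_eq_zero_iff, Ideal.Quotient.eq_zero_iff_mem]

theorem exists_toFunctionField_eq_mul (p : Ideal (MvPolynomial σ K)) [p.IsPrime]
    (Z : Finset (FractionRing (MvPolynomial σ K ⧸ p))) :
    ∃ δ ∉ p, ∀ z ∈ Z, ∃ r, toFunctionField p r = toFunctionField p δ * z := by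
  obtain ⟨d, hd⟩ := IsLocalization.exist_integer_multiples_of_finset
    (nonZeroDivisors (MvPolynomial σ K ⧸ p)) Z
  obtain ⟨δ, hδ⟩ := Ideal.Quotient.mk_surjective (d : MvPolynomial σ K ⧸ p)
  refine ⟨δ, fun h => ?_, fun z hz => ?_⟩
  · rw [Ideal.Quotient.eq_zero_iff_mem.mpr h] at hδ
    exact nonZeroDivisors.coe_ne_zero d hδ.symm
  · obtain ⟨b, hb⟩ := hd z hz
    obtain ⟨r, rfl⟩ := Ideal.Quotient.mk_surjective b
    exact ⟨r, by rw [toFunctionField_apply, hb, toFunctionField_apply, hδ, Algebra.smul_def]⟩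

/-- Over a field `L` of functions of an irreducible affine variety `V(ker α)`, tangent vectors to
the closure of the image of `V(ker α)` under `g` lift to tangent vectors to `V(ker α)`. -/
theorem exists_tangent_lift_of_isFractionRing [Fintype σ] [Fintype τ] [CharZero K] {L : Type}
    (B : Type) [Field L] [CommRing B] [Algebra K L] [Algebra K B] [Algebra B L]
    [IsScalarTower K B L] [IsFractionRing B L] [Algebra.FiniteType K B]
    (α : MvPolynomial σ K →ₐ[K] L) (g : τ → MvPolynomial σ K) (v : τ → L)
    (hv : ∀ f : MvPolynomial τ K, α (aeval g f) = 0 →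
      ∑ t, α (aeval g (pderiv t f)) * v t = 0) :
    ∃ u : σ → L, (∀ f, α f = 0 → ∑ s, α (pderiv s f) * u s = 0) ∧
      ∀ t, v t = ∑ s, α (pderiv s (g t)) * u s := by
  let : Algebra (MvPolynomial σ K) L := α.toAlgebra
  have hσ : ∀ f, algebraMap (MvPolynomial σ K) L f = α f := fun f => rfl
  have : IsScalarTower K (MvPolynomial σ K) L :=
    .of_algebraMap_eq fun c => (α.commutes c).symm
  obtain ⟨u, hu⟩ : ∃ D' : Derivation K L L, ∀ t, D' (α (g t)) = v t := by
    let : Algebra (MvPolynomial τ K) L := (α.comp (aeval g)).toAlgebra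
    have hτ : ∀ f, algebraMap (MvPolynomial τ K) L f = α (aeval g f) := fun f => rfl
    have : IsScalarTower K (MvPolynomial τ K) L :=
      .of_algebraMap_eq fun c => ((α.comp (aeval g)).commutes c).symm
    have hD : ∀ f, mkDerivation K v f = ∑ t, α (aeval g (pderiv t f)) * v t := fun f => by
      rw [derivation_apply_eq_sum]
      simp [Algebra.smul_def, hτ]
    -- The tangent vector `v` is a derivation along `g`, and `hv` says that it kills the kernel. The
    -- values on the coordinates of an extension to `L` form the lift `u`.
    obtain ⟨D', h⟩ := Derivation.exists_extension_of_isFractionRing B (mkDerivation K v)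
      (fun f hf => by rw [hD]; exact hv f hf)
    refine ⟨D', fun t => ?_⟩
    have := h (X t)
    rwa [hτ, aeval_X, mkDerivation_X] at this
  have hD' : ∀ f, u (α f) = ∑ s, α (pderiv s f) * u (α (X s)) := fun f =>
    (derivation_apply_eq_sum (u.compAlgebraMap (MvPolynomial σ K)) f).trans
      (by simp only [Algebra.smul_def]; rfl)
  exact ⟨fun s => u (α (X s)), fun f hf => (hD' f).symm.trans (by rw [hf, map_zero]),
    fun t => (hu t).symm.trans (hD' (g t))⟩

end MvPolynomial

/-- Linear lifts of the vectors in a subspace `⨅ ker ℓᵢ` along a linear map `T`, up to a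
combination of the forms `ℓᵢ`. -/
theorem LinearMap.exists_lift_add_sum {F E E' ι : Type*} [Field F] [AddCommGroup E] [Module F E]
    [AddCommGroup E'] [Module F E'] [FiniteDimensional F E] {τ : Type*}
    (T : E' →ₗ[F] τ → F) (e : E →ₗ[F] τ → F) (N : Submodule F E') (l : ι → E →ₗ[F] F)
    (h : ∀ w, (∀ i, l i w = 0) → ∃ u ∈ N, T u = e w) :
    ∃ (s : E →ₗ[F] E') (c : τ → ι →₀ F), (∀ w, s w ∈ N) ∧
      ∀ w t, e w t = T (s w) t + (c t).sum fun i a => a * l i w := by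
  let W : Submodule F E := ⨅ i, LinearMap.ker (l i)
  obtain ⟨r, hr⟩ := (T.domRestrict N).rangeRestrict.exists_rightInverse_of_surjective
    (LinearMap.range_rangeRestrict _)
  let j : W →ₗ[F] LinearMap.range (T.domRestrict N) :=
    (e.comp W.subtype).codRestrict _ (fun w => by
      obtain ⟨u, hu, hw⟩ := h w (fun i => by simpa using (Submodule.mem_iInf _).mp w.2 i)
      exact ⟨⟨u, hu⟩, hw⟩)
  obtain ⟨s, hs⟩ := LinearMap.exists_extend (r.comp j)
  have hsW : ∀ w ∈ W, T (s w) = e w := fun w hw => by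
    have h1 : s w = r (j ⟨w, hw⟩) := LinearMap.congr_fun hs ⟨w, hw⟩
    have h2 := congrArg Subtype.val (LinearMap.congr_fun hr (j ⟨w, hw⟩))
    rw [h1]
    exact h2
  -- `e - T ∘ s` vanishes on `W`, the common kernel of the `l i`, so each of its coordinates is a
  -- combination of finitely many `l i`.
  have hspan : ∀ t, ∃ c : ι →₀ F, c.sum (fun i a => a • l i) =
      (LinearMap.proj t).comp (e - T.comp (N.subtype.comp s)) := fun t => by
    rw [← Finsupp.mem_span_range_iff_exists_finsupp]
    refine FiniteDimensional.mem_span_of_iInf_ker_le_ker fun w hw => ?_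
    simp [hsW w hw]
  choose c hc using hspan
  refine ⟨N.subtype.comp s, c, fun w => (s w).2, fun w t => ?_⟩
  have := LinearMap.congr_fun (hc t) w
  simp only [Finsupp.sum, LinearMap.sum_apply, LinearMap.smul_apply, smul_eq_mul] at this
  rw [Finsupp.sum, this]
  simp

namespace MvPolynomial

variable {σ τ : Type} {K : Type} [Field K]

theorem eval_aeval (x : σ → K) (g : τ → MvPolynomial σ K) (f : MvPolynomial τ K) :
    eval x (aeval g f) = eval (fun t => eval x (g t)) f := by
  rw [aeval_eq_bind₁, ← aeval_eq_eval, aeval_bind₁, aeval_eq_eval, aeval_eq_eval]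

/-- Generic smoothness, in terms of a map `α` from polynomials to the function field: at a general point `x` of an irreducible affine variety `V(ker α)`, the
differential of `g` maps the tangent space of `V(ker α)` at `x` onto the tangent space at `g x` of the
closure of the image. -/
theorem exists_eval_ne_zero_imp_tangent_surjective_of_isFractionRing [Fintype σ] [Fintype τ] [CharZero K] {L : Type}
    (B : Type) [Field L] [CommRing B] [Algebra K L] [Algebra K B] [Algebra B L]
    [IsScalarTower K B L] [IsFractionRing B L] [Algebra.FiniteType K B]
    (α : MvPolynomial σ K →ₐ[K] L)
    (hα : ∀ Z : Finset L, ∃ δ, α δ ≠ 0 ∧ ∀ z ∈ Z, ∃ r, α r = α δ * z)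
    (g : τ → MvPolynomial σ K) :
    ∃ b, α b ≠ 0 ∧ ∀ x : σ → K, (∀ f, α f = 0 → eval x f = 0) → eval x b ≠ 0 → ∀ v : τ → K,
      (∀ f, α (aeval g f) = 0 → ∑ t, eval (fun t => eval x (g t)) (pderiv t f) * v t = 0) →
      ∃ u : σ → K, (∀ f, α f = 0 → ∑ s, eval x (pderiv s f) * u s = 0) ∧
        ∀ t, v t = ∑ s, eval x (pderiv s (g t)) * u s := by
  classical
  let T : (σ → L) →ₗ[L] τ → L :=
    LinearMap.pi fun t => ∑ s, α (pderiv s (g t)) • LinearMap.proj s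
  have hT : ∀ u t, T u t = ∑ s, α (pderiv s (g t)) * u s := fun u t => by simp [T]
  let l : {f : MvPolynomial τ K // α (aeval g f) = 0} → (τ → L) →ₗ[L] L := fun f =>
    ∑ t, α (aeval g (pderiv t f.1)) • LinearMap.proj t
  have hl : ∀ f v, l f v = ∑ t, α (aeval g (pderiv t f.1)) * v t := fun u t => by simp [l]
  let N : Submodule L (σ → L) :=
    ⨅ f : {f // α f = 0}, LinearMap.ker (∑ s, α (pderiv s f.1) • (LinearMap.proj s : (σ → L) →ₗ[L] L))
  have hN : ∀ u, u ∈ N ↔ ∀ f, α f = 0 → ∑ s, α (pderiv s f) * u s = 0 := fun u => by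
    simp [N, Submodule.mem_iInf]
  have hlift : ∀ w : τ → L, (∀ f, l f w = 0) →
      ∃ u ∈ N, T u = (LinearMap.id : (τ → L) →ₗ[L] τ → L) w := fun w hw => by
    obtain ⟨u, hu, hgu⟩ := exists_tangent_lift_of_isFractionRing B α g w
      (fun f hf => by rw [← hl ⟨f, hf⟩ w]; exact hw _)
    refine ⟨u, (hN u).mpr hu, ?_⟩
    ext t
    rw [hT u t, LinearMap.id_apply, hgu t]
  obtain ⟨e, c, heN, hec⟩ := T.exists_lift_add_sum LinearMap.id N l hlift
  -- One common denominator `δ` for the matrix of the lift `e` and all coefficients `c`; the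
  -- identities over `L` become polynomial identities modulo `ker α` and can be evaluated at points.
  obtain ⟨δ, hδ, hZ⟩ := hα ((Finset.univ.image fun q : τ × σ => e (Pi.single q.1 1) q.2) ∪
      Finset.univ.biUnion fun t => (c t).support.image (c t))
  have h1 : ∀ t s, ∃ r, α r = α δ * e (Pi.single t 1) s := fun t s =>
    hZ _ (Finset.mem_union_left _ (Finset.mem_image_of_mem
      (fun q : τ × σ => e (Pi.single q.1 1) q.2) (Finset.mem_univ (t, s))))
  have h2 : ∀ t f, ∃ r, α r = α δ * c t f := fun t f => by
    by_cases hf : f ∈ (c t).support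
    · exact hZ _ (Finset.mem_union_right _ (Finset.mem_biUnion.mpr
        ⟨t, Finset.mem_univ _, Finset.mem_image_of_mem _ hf⟩))
    · exact ⟨0, by rw [Finsupp.notMem_support_iff.mp hf]; simp⟩
  choose E hE using h1
  choose γ hγ using h2
  have hEp : ∀ f, α f = 0 → ∀ t, α (∑ s, pderiv s f * E t s) = 0 := fun f hf t => by
    have := (hN _).mp (heN (Pi.single t 1)) f hf
    simp only [map_sum, map_mul, hE, mul_left_comm _ (α δ), ← Finset.mul_sum, this, mul_zero]
  have hδp : ∀ t t', α ((if t = t' then δ else 0) - (∑ s, pderiv s (g t) * E t' s +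
      ∑ f ∈ (c t).support, γ t f * aeval g (pderiv t' f.1))) = 0 := fun t t' => by
    have := hec (Pi.single t' 1) t
    rw [hT, Finsupp.sum] at this
    simp only [hl, Pi.single_apply, LinearMap.id_apply, mul_ite, mul_one, mul_zero,
      Finset.sum_ite_eq', Finset.mem_univ, if_true] at this
    have h3 : α (if t = t' then δ else 0) = α δ * if t = t' then 1 else 0 := by
      split_ifs <;> simp
    rw [map_sub, h3, this]
    simp only [map_add, map_sum, map_mul, hE, hγ, mul_add, Finset.mul_sum, mul_left_comm _ (α δ),
      mul_assoc, sub_self]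
  refine ⟨δ, hδ, fun x hx hδx v hv => ?_⟩
  refine ⟨fun s => (eval x δ)⁻¹ * ∑ t, eval x (E t s) * v t, fun f hf => ?_, fun t => ?_⟩
  · have : ∀ t, ∑ s, eval x (pderiv s f) * eval x (E t s) = 0 := fun t => by
      simpa using hx _ (hEp f hf t)
    simp only [mul_left_comm _ (eval x δ)⁻¹, ← Finset.mul_sum]
    simp only [Finset.mul_sum, ← mul_assoc]
    rw [Finset.sum_comm]
    simp only [mul_assoc (eval x δ)⁻¹, ← Finset.mul_sum]
    simp only [← Finset.sum_mul, this, zero_mul, Finset.sum_const_zero, mul_zero]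
  · have hδ' : ∀ t', (if t = t' then eval x δ else 0) =
        ∑ s, eval x (pderiv s (g t)) * eval x (E t' s) +
        ∑ f ∈ (c t).support, eval x (γ t f) *
          eval (fun t => eval x (g t)) (pderiv t' f.1) := fun t' => by
      have := hx _ (hδp t t')
      rw [map_sub, sub_eq_zero, apply_ite (eval x)] at this
      simpa only [map_add, map_sum, map_mul, map_zero, eval_aeval] using this
    have h4 : eval x δ * v t = ∑ t', (if t = t' then eval x δ else 0) * v t' := by simp
    have h5 : ∑ t', (∑ f ∈ (c t).support, eval x (γ t f) *
          eval (fun t => eval x (g t)) (pderiv t' f.1)) * v t' = 0 := by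
      simp only [Finset.sum_mul]
      rw [Finset.sum_comm]
      refine Finset.sum_eq_zero fun f _ => ?_
      simp only [mul_assoc, ← Finset.mul_sum, hv f.1 f.2, mul_zero]
    simp only [hδ', add_mul, Finset.sum_add_distrib, h5, add_zero] at h4
    simp only [mul_left_comm _ (eval x δ)⁻¹, ← Finset.mul_sum]
    rw [eq_inv_mul_iff_mul_eq₀ hδx, h4]
    simp only [Finset.mul_sum, Finset.sum_mul, ← mul_assoc]
    exact Finset.sum_comm

/-- Generic smoothness: at a general point `x` of an irreducible affine variety `V(p)`, the
differential of `g` maps the tangent space of `V(p)` at `x` onto the tangent space at `g x` of the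
closure of the image of `V(p)`. -/
theorem exists_eval_ne_zero_imp_tangent_surjective [Fintype σ] [Fintype τ] [CharZero K] (p : Ideal (MvPolynomial σ K))
    [p.IsPrime] (g : τ → MvPolynomial σ K) :
    ∃ b ∉ p, ∀ x : σ → K, (∀ f ∈ p, eval x f = 0) → eval x b ≠ 0 → ∀ v : τ → K,
      (∀ f, aeval g f ∈ p → ∑ t, eval (fun t => eval x (g t)) (pderiv t f) * v t = 0) →
      ∃ u : σ → K, (∀ f ∈ p, ∑ s, eval x (pderiv s f) * u s = 0) ∧
        ∀ t, v t = ∑ s, eval x (pderiv s (g t)) * u s := by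
  have h := exists_eval_ne_zero_imp_tangent_surjective_of_isFractionRing (MvPolynomial σ K ⧸ p)
    (toFunctionField p) (fun Z => by
      simpa only [ne_eq, toFunctionField_eq_zero_iff] using exists_toFunctionField_eq_mul p Z) g
  simpa only [ne_eq, toFunctionField_eq_zero_iff] using h

end MvPolynomial

/-! ### Homogeneous components and scaling -/

namespace MvPolynomial

variable {ι K : Type} [Field K]

theorem IsHomogeneous.eval_smul {f : MvPolynomial ι K} {d : ℕ} (hf : f.IsHomogeneous d) (c : K)
    (x : ι → K) : eval (c • x) f = c ^ d * eval x f := by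
  rw [eval_eq, eval_eq, Finset.mul_sum]
  refine Finset.sum_congr rfl fun m hm => ?_
  have hd : ∑ i ∈ m.support, m i = d := by
    have := hf (mem_support_iff.mp hm)
    simpa [Finsupp.weight_apply, Finsupp.sum] using this
  simp only [Pi.smul_apply, smul_eq_mul, mul_pow, Finset.prod_mul_distrib, Finset.prod_pow_eq_pow_sum,
    hd]
  ring

theorem eval_smul_eq_sum_homogeneousComponent (f : MvPolynomial ι K) (c : K) (x : ι → K) :
    eval (c • x) f =
      ∑ d ∈ Finset.range (f.totalDegree + 1), c ^ d * eval x (homogeneousComponent d f) := by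
  conv_lhs => rw [← sum_homogeneousComponent f]
  rw [map_sum]
  exact Finset.sum_congr rfl fun d _ => (homogeneousComponent_isHomogeneous d f).eval_smul c x

theorem exists_eval_homogeneousComponent_ne_zero {f : MvPolynomial ι K} {x : ι → K}
    (h : eval x f ≠ 0) : ∃ d, eval x (homogeneousComponent d f) ≠ 0 := by
  by_contra! hcon
  refine h ?_
  have := eval_smul_eq_sum_homogeneousComponent f 1 x
  simpa [hcon] using this

/-- As a function of `c`, `eval (c • x) f` is a polynomial whose coefficients are the homogeneous
components of `f` at `x`. -/
theorem finite_setOf_eval_smul_eq_zero {f : MvPolynomial ι K} {x : ι → K} {d : ℕ}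
    (h : eval x (homogeneousComponent d f) ≠ 0) : {c : K | eval (c • x) f = 0}.Finite := by
  classical
  let q : Polynomial K := ∑ d ∈ Finset.range (f.totalDegree + 1),
    Polynomial.monomial d (eval x (homogeneousComponent d f))
  have hd : d < f.totalDegree + 1 := by
    by_contra hd
    rw [homogeneousComponent_eq_zero _ _ (by omega), map_zero] at h
    exact h rfl
  have hq : q ≠ 0 := fun h0 => h <| by
    have : q.coeff d = 0 := by rw [h0, Polynomial.coeff_zero]
    simpa [q, Polynomial.finsetSum_coeff, Polynomial.coeff_monomial, hd] using this
  refine (q.roots.toFinset.finite_toSet).subset fun c hc => ?_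
  have hc' : eval (c • x) f = 0 := hc
  rw [eval_smul_eq_sum_homogeneousComponent] at hc'
  simp only [Finset.mem_coe, Multiset.mem_toFinset, Polynomial.mem_roots hq, Polynomial.IsRoot,
    q, Polynomial.eval_finsetSum, Polynomial.eval_monomial]
  rw [← hc']
  exact Finset.sum_congr rfl fun _ _ => mul_comm _ _

theorem exists_ne_zero_eval_smul_ne_zero [Infinite K] {f : MvPolynomial ι K} {x : ι → K} {d : ℕ}
    (h : eval x (homogeneousComponent d f) ≠ 0) : ∃ c : K, c ≠ 0 ∧ eval (c • x) f ≠ 0 := by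
  obtain ⟨c, hc⟩ :=
    ((finite_setOf_eval_smul_eq_zero h).union (Set.finite_singleton 0)).exists_notMem
  simp only [Set.mem_union, Set.mem_ofPred_eq, Set.mem_singleton_iff, not_or] at hc
  exact ⟨c, hc.2, hc.1⟩

theorem pderiv_aeval_X_add_C (c : ι → K) (a : ι) (f : MvPolynomial ι K) :
    pderiv a (aeval (fun i => X i + C (c i)) f) =
      aeval (fun i => (X i + C (c i) : MvPolynomial ι K)) (pderiv a f) := by
  classical
  induction f using MvPolynomial.induction_on with
  | C r => simp only [algHom_C, algebraMap_eq, pderiv_C, map_zero]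
  | add p q hp hq => simp only [map_add, hp, hq]
  | mul_X p i hp =>
    simp only [map_mul, pderiv_mul, hp, aeval_X, map_add, pderiv_C, add_zero]
    congr 2
    by_cases h : i = a
    · subst h; simp
    · simp [pderiv_X_of_ne h]

end MvPolynomial

/-! ### Cones and the prime ideal of their product -/

namespace JoinDecomp

open MvPolynomial

variable {n k : ℕ}

theorem eval_rep_mk_eq_zero_iff {f : MvPolynomial (Fin (n + 1)) ℂ} {d : ℕ}
    (hf : f.IsHomogeneous d) {v : Vec n} (hv : v ≠ 0) :
    eval (Projectivization.mk ℂ v hv).rep f = 0 ↔ eval v f = 0 := by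
  obtain ⟨c, hc⟩ := Projectivization.exists_smul_eq_mk_rep ℂ v hv
  rw [← hc, Units.smul_def, hf.eval_smul]
  simp

theorem isClosed_projZariski_iff (Z : Set (PSpace n)) : IsClosed[projZariski n] Z ↔
    ∃ S : Set (MvPolynomial (Fin (n + 1)) ℂ),
      (∀ f ∈ S, ∃ d, f.IsHomogeneous d) ∧ Z = projZeros S := by
  rw [← @isOpen_compl_iff _ _ (projZariski n)]
  change Zᶜᶜ ∈ _ ↔ _
  rw [compl_compl]
  rfl

theorem isClosed_projZeros {S : Set (MvPolynomial (Fin (n + 1)) ℂ)}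
    (hS : ∀ f ∈ S, ∃ d, f.IsHomogeneous d) : IsClosed[projZariski n] (projZeros S) :=
  (isClosed_projZariski_iff _).mpr ⟨S, hS, rfl⟩

theorem isOpen_setOf_eval_rep_ne_zero {f : MvPolynomial (Fin (n + 1)) ℂ} {d : ℕ}
    (hf : f.IsHomogeneous d) : IsOpen[projZariski n] {x | eval x.rep f ≠ 0} := by
  have := isClosed_projZeros (S := {f}) (by rintro _ rfl; exact ⟨d, hf⟩)
  rw [← @isOpen_compl_iff _ _ (projZariski n)] at this
  convert this using 1
  ext x
  simp [projZeros]

theorem smul_mem_cone {X : Set (PSpace n)} {v : Vec n} (hv : v ∈ cone X) {c : ℂ} (hc : c ≠ 0) :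
    c • v ∈ cone X := by
  obtain ⟨h0, h⟩ := hv
  refine ⟨smul_ne_zero hc h0, ?_⟩
  convert h using 1
  rw [Projectivization.mk_eq_mk_iff']
  exact ⟨c, rfl⟩

theorem rep_mem_cone {X : Set (PSpace n)} {x : PSpace n} (hx : x ∈ X) : x.rep ∈ cone X :=
  ⟨x.rep_nonzero, by rwa [Projectivization.mk_rep]⟩

/-- Irreducibility passes from `X` to its cone: nonzero homogeneous components give open sets that
meet in `X`, and all but finitely many multiples of a common point serve both polynomials. -/
theorem IsProjectiveVariety.exists_mem_cone_eval_ne_zero {X : Set (PSpace n)}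
    (hX : IsProjectiveVariety X) {f g : MvPolynomial (Fin (n + 1)) ℂ}
    (hf : ∃ x ∈ cone X, eval x f ≠ 0) (hg : ∃ x ∈ cone X, eval x g ≠ 0) :
    ∃ x ∈ cone X, eval x f ≠ 0 ∧ eval x g ≠ 0 := by
  obtain ⟨x, ⟨hx0, hx⟩, hfx⟩ := hf
  obtain ⟨y, ⟨hy0, hy⟩, hgy⟩ := hg
  obtain ⟨d, hd⟩ := exists_eval_homogeneousComponent_ne_zero hfx
  obtain ⟨e, he⟩ := exists_eval_homogeneousComponent_ne_zero hgy
  have hfd := homogeneousComponent_isHomogeneous d f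
  have hge := homogeneousComponent_isHomogeneous e g
  obtain ⟨z, hzX, hz1, hz2⟩ := hX.2.2 _ _ (isOpen_setOf_eval_rep_ne_zero hfd)
    (isOpen_setOf_eval_rep_ne_zero hge)
    ⟨_, hx, fun h => hd ((eval_rep_mk_eq_zero_iff hfd hx0).mp h)⟩
    ⟨_, hy, fun h => he ((eval_rep_mk_eq_zero_iff hge hy0).mp h)⟩
  obtain ⟨c, hc⟩ := (((finite_setOf_eval_smul_eq_zero hz1).union
    (finite_setOf_eval_smul_eq_zero hz2)).union (Set.finite_singleton 0)).exists_notMem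
  simp only [Set.mem_union, Set.mem_ofPred_eq, Set.mem_singleton_iff, not_or] at hc
  exact ⟨c • z.rep, smul_mem_cone (rep_mem_cone hzX) hc.2, hc.1⟩

/-- The coordinates of a tuple of vectors. -/
def tupleCoords (P : Fin k → Vec n) : Fin k × Fin (n + 1) → ℂ := fun a => P a.1 a.2

theorem eval_tupleCoords_update (F : MvPolynomial (Fin k × Fin (n + 1)) ℂ) (P : Fin k → Vec n)
    (j : Fin k) (x : Vec n) :
    eval (tupleCoords (Function.update P j x)) F =
      eval x (aeval (fun a => if a.1 = j then X a.2 else C (P a.1 a.2)) F) := by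
  rw [eval_aeval]
  congr 2
  ext a
  by_cases h : a.1 = j
  · obtain ⟨i, b⟩ := a
    obtain rfl : i = j := h
    simp [tupleCoords]
  · simp [tupleCoords, h]

/-- A product of irreducible varieties is irreducible. -/
theorem exists_mem_coneTuples_eval_ne_zero {X : Fin k → Set (PSpace n)}
    (hX : ∀ i, IsProjectiveVariety (X i)) {F G : MvPolynomial (Fin k × Fin (n + 1)) ℂ}
    (hF : ∃ P ∈ coneTuples X, eval (tupleCoords P) F ≠ 0)
    (hG : ∃ P ∈ coneTuples X, eval (tupleCoords P) G ≠ 0) :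
    ∃ P ∈ coneTuples X, eval (tupleCoords P) F ≠ 0 ∧ eval (tupleCoords P) G ≠ 0 := by
  -- The two witnesses are made to agree one slot at a time, each time by irreducibility of a single
  -- cone.
  have key : ∀ s : Finset (Fin k), ∃ P ∈ coneTuples X, ∃ Q ∈ coneTuples X,
      eval (tupleCoords P) F ≠ 0 ∧ eval (tupleCoords Q) G ≠ 0 ∧ ∀ i ∈ s, P i = Q i := by
    intro s
    induction s using Finset.induction_on with
    | empty =>
      obtain ⟨P, hP, hPF⟩ := hF
      obtain ⟨Q, hQ, hQG⟩ := hG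
      exact ⟨P, hP, Q, hQ, hPF, hQG, by simp⟩
    | insert j s _ ih =>
      obtain ⟨P, hP, Q, hQ, hPF, hQG, h⟩ := ih
      obtain ⟨x, hx, hxF, hxG⟩ := (hX j).exists_mem_cone_eval_ne_zero
        ⟨P j, hP j, by rw [← eval_tupleCoords_update, Function.update_eq_self]; exact hPF⟩
        ⟨Q j, hQ j, by rw [← eval_tupleCoords_update, Function.update_eq_self]; exact hQG⟩
      rw [← eval_tupleCoords_update] at hxF hxG
      have hup : ∀ R ∈ coneTuples X, Function.update R j x ∈ coneTuples X := fun R hR i => by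
        by_cases hi : i = j
        · subst hi; simpa using hx
        · simpa [hi] using hR i
      refine ⟨_, hup P hP, _, hup Q hQ, hxF, hxG, fun i hi => ?_⟩
      by_cases hij : i = j
      · subst hij; simp
      · simpa [hij] using h i (Finset.mem_of_mem_insert_of_ne hi hij)
  obtain ⟨P, hP, Q, hQ, hPF, hQG, h⟩ := key Finset.univ
  obtain rfl : P = Q := funext fun i => h i (Finset.mem_univ i)
  exact ⟨P, hP, hPF, hQG⟩

/-- The ideal of all polynomials that vanish on the product of the cones. -/
noncomputable def tupleIdeal (X : Fin k → Set (PSpace n)) : Ideal (MvPolynomial (Fin k × Fin (n + 1)) ℂ) :=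
  vanishingIdeal ℂ (tupleCoords '' coneTuples X)

variable {X : Fin k → Set (PSpace n)}

theorem mem_tupleIdeal {F : MvPolynomial (Fin k × Fin (n + 1)) ℂ} :
    F ∈ tupleIdeal X ↔ ∀ P ∈ coneTuples X, eval (tupleCoords P) F = 0 := by
  simp [tupleIdeal, aeval_eq_eval]

theorem notMem_tupleIdeal {F : MvPolynomial (Fin k × Fin (n + 1)) ℂ} :
    F ∉ tupleIdeal X ↔ ∃ P ∈ coneTuples X, eval (tupleCoords P) F ≠ 0 := by
  simp [mem_tupleIdeal]

theorem tupleIdeal_isPrime (hX : ∀ i, IsProjectiveVariety (X i)) : (tupleIdeal X).IsPrime := by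
  refine Ideal.isPrime_iff.mpr ⟨?_, fun {F G} h => ?_⟩
  · have hne : ∀ i, ∃ v, v ∈ cone (X i) := fun i => by
      obtain ⟨x, hx⟩ := (hX i).2.1
      exact ⟨_, rep_mem_cone hx⟩
    choose P hP using hne
    exact (Ideal.ne_top_iff_one _).mpr (notMem_tupleIdeal.mpr ⟨P, hP, by simp⟩)
  · by_contra! hcon
    obtain ⟨P, hP, h1, h2⟩ := exists_mem_coneTuples_eval_ne_zero hX
      (notMem_tupleIdeal.mp hcon.1) (notMem_tupleIdeal.mp hcon.2)
    have := mem_tupleIdeal.mp h P hP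
    rw [map_mul] at this
    exact mul_ne_zero h1 h2 this

theorem eval_tupleCoords_rename (P : Fin k → Vec n) (i : Fin k)
    (f : MvPolynomial (Fin (n + 1)) ℂ) :
    eval (tupleCoords P) (rename (Prod.mk i) f) = eval (P i) f := by
  rw [eval_rename]
  rfl

/-- The homogeneous equations of `X i`, read in the `i`-th slot, lie in `tupleIdeal X`. Only zero
entries, which lie in no cone, must be excluded. -/
theorem mem_coneTuples_of_forall_mem_tupleIdeal (hX : ∀ i, IsProjectiveVariety (X i))
    {P : Fin k → Vec n} (hP : ∀ F ∈ tupleIdeal X, eval (tupleCoords P) F = 0)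
    (hP0 : ∀ i, P i ≠ 0) : P ∈ coneTuples X := by
  intro i
  refine ⟨hP0 i, ?_⟩
  obtain ⟨S, hS, hXS⟩ := (isClosed_projZariski_iff _).mp (hX i).1
  rw [hXS]
  intro f hf
  obtain ⟨d, hd⟩ := hS f hf
  rw [eval_rep_mk_eq_zero_iff hd, ← eval_tupleCoords_rename]
  refine hP _ (mem_tupleIdeal.mpr fun Q hQ => ?_)
  obtain ⟨h0, hQi⟩ := hQ i
  rw [eval_tupleCoords_rename, ← eval_rep_mk_eq_zero_iff hd h0]
  rw [hXS] at hQi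
  exact hQi f hf

theorem mem_affineTangent_of_forall_mem_tupleIdeal {P : Fin k → Vec n}
    {u : Fin k × Fin (n + 1) → ℂ}
    (hu : ∀ F ∈ tupleIdeal X, ∑ s, eval (tupleCoords P) (pderiv s F) * u s = 0) (i : Fin k) :
    (fun a => u (i, a)) ∈ affineTangent (X i) (P i) := by
  intro f hf
  have h := hu (rename (Prod.mk i) f) (mem_tupleIdeal.mpr fun Q hQ => by
    rw [eval_tupleCoords_rename]
    simpa [aeval_eq_eval] using hf _ (hQ i))
  rw [Fintype.sum_prod_type, Finset.sum_eq_single i] at h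
  · simpa only [pderiv_rename (Prod.mk_right_injective i), eval_tupleCoords_rename] using h
  · intro i' _ hi'
    refine Finset.sum_eq_zero fun a _ => ?_
    classical
    rw [pderiv_eq_zero_of_notMem_vars, map_zero, zero_mul]
    intro hmem
    obtain ⟨b, _, hb⟩ := Finset.mem_image.mp (vars_rename _ _ hmem)
    exact hi' (congrArg Prod.fst hb).symm
  · simp

/-- The differential of the sum map sends tangent vectors of the cone over `X j` at `Q j` to
tangent vectors of the closure of the image at `∑ i, Q i`. -/
theorem sum_eval_pderiv_mul_eq_zero_of_mem_affineTangent {Q : Fin k → Vec n}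
    (hQ : Q ∈ coneTuples X) {f : MvPolynomial (Fin (n + 1)) ℂ}
    (hf : ∀ P ∈ coneTuples X, eval (∑ i, P i) f = 0) {j : Fin k} {v : Vec n}
    (hv : v ∈ affineTangent (X j) (Q j)) :
    ∑ a, eval (∑ i, Q i) (pderiv a f) * v a = 0 := by
  -- With the other terms frozen, `x ↦ f (x + c)` vanishes on the cone over `X j`, so its
  -- differential at `Q j` kills `v`.
  let c : Vec n := ∑ i ∈ Finset.univ.erase j, Q i
  have hup : ∀ x, x + c = ∑ i, Function.update Q j x i := fun x => by
    rw [← Finset.add_sum_erase _ _ (Finset.mem_univ j), Function.update_self]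
    congr 1
    exact Finset.sum_congr rfl fun i hi => by
      rw [Function.update_of_ne (Finset.ne_of_mem_erase hi)]
  have heval : ∀ x p, eval x (aeval (fun a => (MvPolynomial.X a + C (c a) :
      MvPolynomial (Fin (n + 1)) ℂ)) p) = eval (x + c) p := fun x p => by
    rw [eval_aeval]
    congr 2
    ext a
    simp
  have hsum : Q j + c = ∑ i, Q i := Finset.add_sum_erase _ _ (Finset.mem_univ j)
  have h := hv (aeval (fun a => MvPolynomial.X a + C (c a)) f) (fun x hx => by
    rw [aeval_eq_eval]
    change eval x _ = 0
    rw [heval, hup]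
    refine hf _ fun i => ?_
    by_cases hi : i = j
    · subst hi; simpa using hx
    · simpa [hi] using hQ i)
  simpa only [pderiv_aeval_X_add_C, heval, hsum] using h

end JoinDecomp

/-! ### The sum map, Terracini's lemma and open conditions on tuples -/

namespace JoinDecomp

open MvPolynomial

variable {n k : ℕ} {X : Fin k → Set (PSpace n)}

/-- The polynomials defining the sum map `V^k → V`. -/
noncomputable def sumPolys (k n : ℕ) (a : Fin (n + 1)) : MvPolynomial (Fin k × Fin (n + 1)) ℂ :=
  ∑ i, MvPolynomial.X (i, a)

theorem eval_sumPolys (P : Fin k → Vec n) :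
    (fun a => eval (tupleCoords P) (sumPolys k n a)) = ∑ i, P i := by
  ext a
  simp [sumPolys, tupleCoords]

theorem eval_aeval_sumPolys (P : Fin k → Vec n) (f : MvPolynomial (Fin (n + 1)) ℂ) :
    eval (tupleCoords P) (aeval (sumPolys k n) f) = eval (∑ i, P i) f := by
  rw [eval_aeval, eval_sumPolys]

theorem aeval_sumPolys_mem_tupleIdeal {f : MvPolynomial (Fin (n + 1)) ℂ} :
    aeval (sumPolys k n) f ∈ tupleIdeal X ↔ ∀ P ∈ coneTuples X, eval (∑ i, P i) f = 0 := by
  simp only [mem_tupleIdeal, eval_aeval_sumPolys]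

theorem sum_eval_pderiv_sumPolys_mul (P : Fin k → Vec n) (u : Fin k × Fin (n + 1) → ℂ)
    (a : Fin (n + 1)) :
    ∑ s, eval (tupleCoords P) (pderiv s (sumPolys k n a)) * u s = ∑ i, u (i, a) := by
  classical
  rw [Fintype.sum_prod_type]
  refine Finset.sum_congr rfl fun i _ => ?_
  rw [Finset.sum_eq_single a]
  · simp [sumPolys, pderiv_X, Pi.single_apply]
  · intro b _ hb
    simp [sumPolys, pderiv_X, hb]
  · simp

/-- Terracini's lemma: for general `P`, the tangent space at `∑ i, P i` of the closure of the image
of the sum map is contained in the sum of the tangent spaces at the `P i`. -/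
theorem exists_notMem_tupleIdeal_terracini (hX : ∀ i, IsProjectiveVariety (X i)) :
    ∃ b ∉ tupleIdeal X, ∀ P : Fin k → Vec n,
      (∀ F ∈ tupleIdeal X, eval (tupleCoords P) F = 0) → eval (tupleCoords P) b ≠ 0 →
      ∀ v : Vec n, (∀ f, (∀ Q ∈ coneTuples X, eval (∑ i, Q i) f = 0) →
        ∑ a, eval (∑ i, P i) (pderiv a f) * v a = 0) →
      v ∈ ⨆ i, affineTangent (X i) (P i) := by
  have := tupleIdeal_isPrime hX
  obtain ⟨b, hb, h⟩ := exists_eval_ne_zero_imp_tangent_surjective (tupleIdeal X) (sumPolys k n)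
  refine ⟨b, hb, fun P hP hbP v hv => ?_⟩
  obtain ⟨u, hu, huv⟩ := h _ hP hbP v (fun f hf => by
    rw [eval_sumPolys]
    exact hv f (aeval_sumPolys_mem_tupleIdeal.mp hf))
  have hvu : v = ∑ i, fun a => u (i, a) := by
    ext a
    rw [huv a, sum_eval_pderiv_sumPolys_mul, Finset.sum_apply]
  rw [hvu]
  exact Submodule.sum_mem _ fun i _ => Submodule.mem_iSup_of_mem i
    (mem_affineTangent_of_forall_mem_tupleIdeal hu i)

theorem HoldsGenerally.exists_notMem_tupleIdeal {p : (Fin k → Vec n) → Prop}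
    (h : HoldsGenerally (tupleZariski k n) (coneTuples X) p) (hne : (coneTuples X).Nonempty) :
    ∃ b ∉ tupleIdeal X, ∀ P ∈ coneTuples X, eval (tupleCoords P) b ≠ 0 → p P := by
  obtain ⟨U, hU, hcl, hp⟩ := h
  have hne' : (coneTuples X ∩ U).Nonempty := by
    by_contra hemp
    rw [Set.not_nonempty_iff_eq_empty] at hemp
    rw [hemp, @closure_empty _ (tupleZariski k n)] at hcl
    obtain ⟨P, hP⟩ := hne
    exact hcl hP
  obtain ⟨P, hP, hPU⟩ := hne'
  obtain ⟨O, hO, rfl⟩ := hU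
  obtain ⟨S, hS⟩ : ∃ S : Set (MvPolynomial (Fin k × Fin (n + 1)) ℂ), Oᶜ = affineZeros S := hO
  have hmem : ∀ P : Fin k → Vec n, tupleCoords P ∈ O ↔
      ∃ f ∈ S, eval (tupleCoords P) f ≠ 0 := fun P => by
    rw [← not_iff_not, ← Set.mem_compl_iff, hS]
    simp [affineZeros]
  obtain ⟨f, hf, hfP⟩ := (hmem P).mp hPU
  exact ⟨f, notMem_tupleIdeal.mpr ⟨P, hP, hfP⟩,
    fun Q hQ hfQ => hp Q ⟨hQ, (hmem Q).mpr ⟨f, hf, hfQ⟩⟩⟩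

/-- With `l` a left inverse of the combination map of `P₀`, the determinant of the vectors `l (P i)`
is a polynomial in `P` with value `1` at `P₀`. -/
theorem exists_notMem_tupleIdeal_linearIndependent {P₀ : Fin k → Vec n} (hP₀ : P₀ ∈ coneTuples X)
    (hli : LinearIndependent ℂ P₀) :
    ∃ b ∉ tupleIdeal X, ∀ P, eval (tupleCoords P) b ≠ 0 → LinearIndependent ℂ P := by
  obtain ⟨l, hl⟩ := (Fintype.linearCombination ℂ P₀).exists_leftInverse_of_injective
    (LinearMap.ker_eq_bot.mpr hli.fintypeLinearCombination_injective)
  let M : Matrix (Fin k) (Fin k) (MvPolynomial (Fin k × Fin (n + 1)) ℂ) :=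
    Matrix.of fun i j => ∑ a, MvPolynomial.X (i, a) * C (l (Pi.single a 1) j)
  have hM : ∀ P : Fin k → Vec n, eval (tupleCoords P) M.det =
      (Matrix.of fun i j => l (P i) j).det := fun P => by
    rw [RingHom.map_det]
    congr 1
    ext i j
    have : P i = ∑ a, P i a • Pi.single a (1 : ℂ) := by
      ext b
      simp [Pi.single_apply]
    simp only [RingHom.mapMatrix_apply, Matrix.map_apply, Matrix.of_apply, M]
    conv_rhs => rw [this]
    simp [tupleCoords]
  refine ⟨M.det, notMem_tupleIdeal.mpr ⟨P₀, hP₀, ?_⟩, fun P hP => ?_⟩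
  · have h1 : (Matrix.of fun i j => l (P₀ i) j) = (1 : Matrix (Fin k) (Fin k) ℂ) := by
      ext i j
      have := congrFun (LinearMap.congr_fun hl (Pi.single i 1)) j
      simp only [LinearMap.comp_apply, Fintype.linearCombination_apply_single, one_smul,
        LinearMap.id_apply] at this
      simp [this, Matrix.one_apply, Pi.single_apply, eq_comm]
    rw [hM, h1, Matrix.det_one]
    exact one_ne_zero
  · rw [hM] at hP
    exact LinearIndependent.of_comp l
      (Matrix.linearIndependent_rows_of_isUnit
        ((Matrix.isUnit_iff_isUnit_det _).mpr (isUnit_iff_ne_zero.mpr hP)))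

theorem exists_notMem_tupleIdeal_not_subset (hX : ∀ i, IsProjectiveVariety (X i)) (i j : Fin k) :
    ∃ b ∉ tupleIdeal X, ∀ P ∈ coneTuples X, eval (tupleCoords P) b ≠ 0 →
      P i ∈ cone (X j) → X i ⊆ X j := by
  have := tupleIdeal_isPrime hX
  by_cases h : X i ⊆ X j
  · exact ⟨1, (Ideal.ne_top_iff_one _).mp this.ne_top, fun _ _ _ _ => h⟩
  · obtain ⟨x, hxi, hxj⟩ := Set.not_subset.mp h
    obtain ⟨S, hS, hXS⟩ := (isClosed_projZariski_iff _).mp (hX j).1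
    rw [hXS] at hxj
    simp only [projZeros, Set.mem_ofPred_eq, not_forall] at hxj
    obtain ⟨f, hf, hfx⟩ := hxj
    obtain ⟨d, hd⟩ := hS f hf
    obtain ⟨P, hP⟩ : (coneTuples X).Nonempty := by
      by_contra hemp
      exact this.ne_top ((Ideal.eq_top_iff_one _).mpr
        (mem_tupleIdeal.mpr fun P hP => absurd ⟨P, hP⟩ hemp))
    refine ⟨rename (Prod.mk i) f, notMem_tupleIdeal.mpr
      ⟨Function.update P i x.rep, fun l => ?_, ?_⟩, fun Q _ hQf hQ => ?_⟩
    · by_cases hl : l = i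
      · subst hl; simpa using rep_mem_cone hxi
      · simpa [hl] using hP l
    · rwa [eval_tupleCoords_rename, Function.update_self]
    · obtain ⟨hQ0, hQj⟩ := hQ
      rw [hXS] at hQj
      refine absurd ?_ hQf
      rw [eval_tupleCoords_rename]
      exact (eval_rep_mk_eq_zero_iff hd hQ0).mp (hQj f hf)

/-- Some `c i` may be zero, and `0` lies in no cone. A polynomial in the coefficients that is
nonzero at `c` is also nonzero at a point with no zero coordinate. -/
theorem exists_coneTuples_eval_sum_ne_zero {P : Fin k → Vec n} (hP : P ∈ coneTuples X)
    {h : MvPolynomial (Fin (n + 1)) ℂ} {c : Fin k → ℂ} (hc : eval (∑ i, c i • P i) h ≠ 0) :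
    ∃ Q ∈ coneTuples X, eval (∑ i, Q i) h ≠ 0 := by
  let H : MvPolynomial (Fin k) ℂ := aeval (fun a => ∑ i, MvPolynomial.X i * C (P i a)) h
  have hH : ∀ t, eval t H = eval (∑ i, t i • P i) h := fun t => by
    rw [eval_aeval]
    congr 2
    ext a
    simp
  have hprod : H * ∏ i, MvPolynomial.X i ≠ 0 :=
    mul_ne_zero (fun h0 => hc (by rw [← hH, h0, map_zero]))
      (Finset.prod_ne_zero_iff.mpr fun i _ => X_ne_zero i)
  obtain ⟨t, ht⟩ : ∃ t, eval t (H * ∏ i, MvPolynomial.X i) ≠ 0 := by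
    by_contra! hcon
    exact hprod (MvPolynomial.funext fun t => by rw [hcon, map_zero])
  rw [map_mul, map_prod, hH] at ht
  refine ⟨fun i => t i • P i, fun i => smul_mem_cone (hP i) ?_, left_ne_zero_of_mul ht⟩
  simpa using Finset.prod_ne_zero_iff.mp (right_ne_zero_of_mul ht) i (Finset.mem_univ i)

theorem perm_apply_eq_of_forall_le {ι α : Type*} [Finite ι] [PartialOrder α] (f : ι → α)
    (σ : Equiv.Perm ι) (h : ∀ i, f (σ i) ≤ f i) (i : ι) : f (σ i) = f i := by
  refine le_antisymm (h i) ?_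
  have hpow : ∀ m : ℕ, ∀ j, f ((σ ^ m) j) ≤ f j := fun m => by
    induction m with
    | zero => simp
    | succ m ih => exact fun j => by rw [pow_succ', Equiv.Perm.mul_apply]; exact (h _).trans (ih j)
  have := hpow (orderOf σ - 1) (σ i)
  rwa [← Equiv.Perm.mul_apply, ← pow_succ, Nat.sub_add_cancel (orderOf_pos σ), pow_orderOf_eq_one,
    Equiv.Perm.one_apply] at this

/-- By independence the coefficients over each fibre of `i` sum to `1`. So no fibre is empty, `i` is
bijective and every coefficient is `1`. -/
theorem exists_perm_of_sum_eq_sum {E : Type*} [AddCommGroup E] [Module ℂ E] {P Q : Fin k → E}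
    (hP : LinearIndependent ℂ P) (hPQ : ∀ j, ∃ i, ∃ c : ℂ, Q j = c • P i)
    (hsum : ∑ i, Q i = ∑ i, P i) : ∃ σ : Equiv.Perm (Fin k), ∀ i, Q i = P (σ i) := by
  choose i c hc using hPQ
  have hcoef : ∀ l, ∑ j with i j = l, c j = 1 := by
    have h0 : ∑ l, (∑ j with i j = l, c j) • P l = ∑ l, (1 : ℂ) • P l := by
      simp only [one_smul, ← hsum, hc, Finset.sum_smul]
      refine Eq.trans ?_ (Finset.sum_fiberwise Finset.univ i _)
      refine Finset.sum_congr rfl fun l _ => Finset.sum_congr rfl fun j hj => ?_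
      rw [(Finset.mem_filter.mp hj).2]
    intro l
    have := hP.fintypeLinearCombination_injective (a₁ := fun l => ∑ j with i j = l, c j)
      (a₂ := fun _ => 1) (by simpa only [Fintype.linearCombination_apply] using h0)
    exact congrFun this l
  have hsurj : Function.Surjective i := fun l => by
    by_contra! hl
    have := hcoef l
    rw [Finset.filter_false_of_mem (fun j _ => hl j), Finset.sum_empty] at this
    exact zero_ne_one this
  have hbij : Function.Bijective i := Finite.surjective_iff_bijective.mp hsurj
  refine ⟨Equiv.ofBijective i hbij, fun j => ?_⟩
  have := hcoef (i j)
  rw [show (Finset.univ.filter fun j' => i j' = i j) = {j} by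
    ext j'; simp [hbij.1.eq_iff], Finset.sum_singleton] at this
  rw [hc j, this, one_smul, Equiv.ofBijective_apply]

end JoinDecomp

/-! ### Identifiability of general tuples -/

namespace JoinDecomp

open MvPolynomial

variable {n k : ℕ} {X : Fin k → Set (PSpace n)}

/-- A tuple `P` such that every decomposition of `∑ i, P i` with terms in the cones over the `X i`
arises from `P` by permuting terms that belong to the same variety. -/
def IsIdentifiable (X : Fin k → Set (PSpace n)) (P : Fin k → Vec n) : Prop :=
  P ∈ coneTuples X ∧ ∀ Q ∈ coneTuples X, ∑ i, Q i = ∑ i, P i →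
    ∃ σ : Equiv.Perm (Fin k), (∀ i, X (σ i) = X i) ∧ ∀ i, Q i = P (σ i)

/-- General tuples are identifiable; this includes tuples in the closure of `coneTuples X`. -/
theorem exists_notMem_tupleIdeal_isIdentifiable (hX : ∀ i, IsProjectiveVariety (X i))
    (hJ : NotTangentiallyWeaklyDefective X)
    (hli : ∃ P ∈ coneTuples X, LinearIndependent ℂ P) :
    ∃ b ∉ tupleIdeal X, ∀ P : Fin k → Vec n,
      (∀ F ∈ tupleIdeal X, eval (tupleCoords P) F = 0) → eval (tupleCoords P) b ≠ 0 →
      IsIdentifiable X P := by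
  have hprime := tupleIdeal_isPrime hX
  obtain ⟨P₀, hP₀, hP₀li⟩ := hli
  obtain ⟨b₁, hb₁, h₁⟩ := exists_notMem_tupleIdeal_terracini hX
  obtain ⟨b₂, hb₂, h₂⟩ := HoldsGenerally.exists_notMem_tupleIdeal hJ ⟨P₀, hP₀⟩
  obtain ⟨b₃, hb₃, h₃⟩ := exists_notMem_tupleIdeal_linearIndependent hP₀ hP₀li
  choose b₄ hb₄ h₄ using exists_notMem_tupleIdeal_not_subset hX
  refine ⟨b₁ * b₂ * b₃ * ∏ i, ∏ j, b₄ i j, ?_, fun P hP hbP => ?_⟩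
  · refine hprime.mul_notMem (hprime.mul_notMem (hprime.mul_notMem hb₁ hb₂) hb₃) fun hmem => ?_
    obtain ⟨i, _, hi⟩ := hprime.prod_mem_iff.mp hmem
    obtain ⟨j, _, hj⟩ := hprime.prod_mem_iff.mp hi
    exact hb₄ i j hj
  simp only [map_mul, map_prod, mul_ne_zero_iff, Finset.prod_ne_zero_iff, Finset.mem_univ,
    forall_const] at hbP
  obtain ⟨⟨⟨hP₁, hP₂⟩, hP₃⟩, hP₄⟩ := hbP
  have hPli := h₃ P hP₃
  have hPX : P ∈ coneTuples X :=
    mem_coneTuples_of_forall_mem_tupleIdeal hX hP fun i => hPli.ne_zero i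
  refine ⟨hPX, fun Q hQ hsum => ?_⟩
  -- Terracini at `P` meets the easy inclusion at `Q`, since both sums are the same point.
  have htan : ∀ j, affineTangent (X j) (Q j) ≤ ⨆ i, affineTangent (X i) (P i) := fun j v hv =>
    h₁ P hP hP₁ v fun f hf => by
      rw [← hsum]
      exact sum_eval_pderiv_mul_eq_zero_of_mem_affineTangent hQ hf hv
  obtain ⟨σ, hσ⟩ := exists_perm_of_sum_eq_sum hPli (fun j => by
    obtain ⟨i, c, hc⟩ := h₂ P hPX hP₂ j (Q j) (hQ j) (htan j)
    exact ⟨i, c, hc⟩) hsum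
  refine ⟨σ, perm_apply_eq_of_forall_le X σ fun j => ?_, hσ⟩
  exact h₄ (σ j) j P hPX (hP₄ _ _) (hσ j ▸ hQ j)

/-- Any decomposition of the same point can be rescaled to have sum `∑ i, P i`; two decompositions
are then compared through `P`. -/
theorem IsIdentifiable.hasEssentiallyUniqueDecomposition {P : Fin k → Vec n}
    (hP : IsIdentifiable X P) (h0 : ∑ i, P i ≠ 0) :
    HasEssentiallyUniqueDecomposition X (Projectivization.mk ℂ (∑ i, P i) h0) := by
  have key : ∀ Q, IsDecomposition X (Projectivization.mk ℂ (∑ i, P i) h0) Q →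
      ∃ σ : Equiv.Perm (Fin k), (∀ i, X (σ i) = X i) ∧ ∃ c : ℂˣ, ∀ i, c • Q i = P (σ i) := by
    rintro Q ⟨hQ, hQ0, hmk⟩
    obtain ⟨c, hc⟩ := (Projectivization.mk_eq_mk_iff ℂ _ _ h0 hQ0).mp hmk.symm
    obtain ⟨σ, hσX, hσ⟩ := hP.2 (fun i => c • Q i) (fun i => smul_mem_cone (hQ i) c.ne_zero)
      (by rw [← Finset.smul_sum, hc])
    exact ⟨σ, hσX, c, hσ⟩
  refine ⟨⟨P, hP.1, h0, rfl⟩, fun Q R hQ hR => ?_⟩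
  obtain ⟨σ, hσX, c, hσ⟩ := key Q hQ
  obtain ⟨τ, hτX, d, hτ⟩ := key R hR
  refine ⟨τ.trans σ.symm, fun i => ?_, d⁻¹ * c, fun i => ?_⟩
  · rw [← hσX, Equiv.trans_apply, Equiv.apply_symm_apply, hτX]
  · rw [mul_smul, hσ, Equiv.trans_apply, Equiv.apply_symm_apply, ← hτ, inv_smul_smul]

/-! ### The join and the image of the sum map -/

/-- The union of the spans of linearly independent tuples, whose closure is the join. -/
def spanUnion (X : Fin k → Set (PSpace n)) : Set (PSpace n) :=
  {x | ∃ P ∈ coneTuples X, LinearIndependent ℂ P ∧ x.submodule ≤ Submodule.span ℂ (Set.range P)}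

theorem spanUnion_subset_join : spanUnion X ⊆ join X :=
  @subset_closure _ (projZariski n) _

theorem exists_sum_smul_eq_rep {P : Fin k → Vec n} {x : PSpace n}
    (hx : x.submodule ≤ Submodule.span ℂ (Set.range P)) :
    ∃ c : Fin k → ℂ, ∑ i, c i • P i = x.rep := by
  rw [Projectivization.submodule_eq] at hx
  exact (Submodule.mem_span_range_iff_exists_fun ℂ).mp (hx (Submodule.mem_span_singleton_self _))

theorem eval_rep_eq_zero_of_mem_join {f : MvPolynomial (Fin (n + 1)) ℂ} {d : ℕ}
    (hf : f.IsHomogeneous d) (h : ∀ P ∈ coneTuples X, eval (∑ i, P i) f = 0) {x : PSpace n}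
    (hx : x ∈ join X) : eval x.rep f = 0 := by
  have hcl := isClosed_projZeros (n := n) (S := {f}) (by rintro _ rfl; exact ⟨d, hf⟩)
  suffices hsub : spanUnion X ⊆ projZeros {f} from
    (@closure_minimal _ (projZariski n) _ _ hsub hcl : join X ⊆ _) hx f rfl
  rintro y ⟨P, hP, _, hy⟩ _ rfl
  obtain ⟨c, hc⟩ := exists_sum_smul_eq_rep hy
  by_contra hne
  rw [← hc] at hne
  obtain ⟨Q, hQ, hQf⟩ := exists_coneTuples_eval_sum_ne_zero hP hne
  exact hQf (h Q hQ)

/-- The image of the sum map is stable under nonzero scalars, so the homogeneous components of `f`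
vanish on it too. -/
theorem eval_smul_rep_eq_zero_of_mem_join {f : MvPolynomial (Fin (n + 1)) ℂ}
    (h : ∀ P ∈ coneTuples X, eval (∑ i, P i) f = 0) {x : PSpace n} (hx : x ∈ join X) (c : ℂ) :
    eval (c • x.rep) f = 0 := by
  rw [eval_smul_eq_sum_homogeneousComponent]
  refine Finset.sum_eq_zero fun d _ => ?_
  rw [eval_rep_eq_zero_of_mem_join (homogeneousComponent_isHomogeneous d f) _ hx, mul_zero]
  intro P hP
  by_contra hne
  obtain ⟨t, ht, hft⟩ := exists_ne_zero_eval_smul_ne_zero hne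
  rw [Finset.smul_sum] at hft
  exact hft (h _ fun i => smul_mem_cone (hP i) ht)

/-- Near a point of a span, three nonempty open conditions on the irreducible product hold at once:
the sum stays in the neighbourhood, `f` is nonzero at the sum, the tuple is independent. -/
theorem join_subset_closure_inter (hX : ∀ i, IsProjectiveVariety (X i))
    {f : MvPolynomial (Fin (n + 1)) ℂ} {d : ℕ} (hf : f.IsHomogeneous d)
    (hne : ∃ P ∈ coneTuples X, eval (∑ i, P i) f ≠ 0) :
    join X ⊆ closure[projZariski n] (join X ∩ {x | eval x.rep f ≠ 0}) := by
  have hprime := tupleIdeal_isPrime hX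
  refine @closure_minimal _ (projZariski n) _ _ ?_ (@isClosed_closure _ (projZariski n) _)
  rintro x ⟨P, hP, hPli, hx⟩
  obtain ⟨c, hc⟩ := exists_sum_smul_eq_rep hx
  rw [@mem_closure_iff _ (projZariski n)]
  intro O hO hxO
  rw [← compl_compl O, @isOpen_compl_iff _ _ (projZariski n)] at hO
  obtain ⟨S, hS, hOS⟩ := (isClosed_projZariski_iff _).mp hO
  have hmem : ∀ y, y ∈ O ↔ ∃ h ∈ S, eval y.rep h ≠ 0 := fun y => by
    rw [← not_iff_not, ← Set.mem_compl_iff, hOS]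
    simp [projZeros]
  obtain ⟨h, hhS, hhx⟩ := (hmem x).mp hxO
  obtain ⟨e, he⟩ := hS h hhS
  have hh : aeval (sumPolys k n) h ∉ tupleIdeal X := fun hcon => by
    obtain ⟨Q, hQ, hQh⟩ := exists_coneTuples_eval_sum_ne_zero hP (hc ▸ hhx)
    exact hQh (aeval_sumPolys_mem_tupleIdeal.mp hcon Q hQ)
  have hf' : aeval (sumPolys k n) f ∉ tupleIdeal X := fun hcon => by
    obtain ⟨Q, hQ, hQf⟩ := hne
    exact hQf (aeval_sumPolys_mem_tupleIdeal.mp hcon Q hQ)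
  obtain ⟨m, hm, hmli⟩ := exists_notMem_tupleIdeal_linearIndependent hP hPli
  obtain ⟨Q, hQ, hQne⟩ := notMem_tupleIdeal.mp (hprime.mul_notMem (hprime.mul_notMem hh hf') hm)
  simp only [map_mul, mul_ne_zero_iff, eval_aeval_sumPolys] at hQne
  obtain ⟨⟨hQh, hQf⟩, hQm⟩ := hQne
  have hQli := hmli Q hQm
  -- A zero sum of independent vectors forces `k = 0`, and then no span contains the point `x`.
  have hQ0 : ∑ i, Q i ≠ 0 := fun h0 => by
    have h1 := Fintype.linearIndependent_iff.mp hQli (fun _ => 1) (by simpa using h0)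
    have : IsEmpty (Fin k) := ⟨fun i => one_ne_zero (h1 i)⟩
    exact x.rep_nonzero (by rw [← hc, Finset.univ_eq_empty, Finset.sum_empty])
  refine ⟨Projectivization.mk ℂ _ hQ0, (hmem _).mpr ⟨h, hhS, fun h0 => hQh ?_⟩,
    spanUnion_subset_join ⟨Q, hQ, hQli, ?_⟩, fun h0 => hQf ?_⟩
  · exact (eval_rep_mk_eq_zero_iff he hQ0).mp h0
  · rw [Projectivization.submodule_mk, Submodule.span_singleton_le_iff_mem]
    exact Submodule.sum_mem _ fun i _ => Submodule.subset_span ⟨i, rfl⟩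
  · exact (eval_rep_mk_eq_zero_iff hf hQ0).mp h0

theorem join_eq_empty (h : ¬ ∃ P ∈ coneTuples X, LinearIndependent ℂ P) : join X = ∅ := by
  have : spanUnion X = ∅ := Set.eq_empty_of_forall_notMem fun x ⟨P, hP, hli, _⟩ => h ⟨P, hP, hli⟩
  change closure[projZariski n] (spanUnion X) = ∅
  rw [this, @closure_empty _ (projZariski n)]

end JoinDecomp

/-! ### Descent to a general point of the join -/

open MvPolynomial JoinDecomp in
theorem mainTheorem4 (n k : ℕ) (X : Fin k → Set (JoinDecomp.PSpace n))
    (hX : ∀ i, JoinDecomp.IsProjectiveVariety (X i))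
    (hJ : JoinDecomp.NotTangentiallyWeaklyDefective X) :
    JoinDecomp.HoldsGenerally (JoinDecomp.projZariski n) (JoinDecomp.join X)
      (JoinDecomp.HasEssentiallyUniqueDecomposition X) := by
  by_cases hli : ∃ P ∈ coneTuples X, LinearIndependent ℂ P
  swap
  · rw [join_eq_empty hli]
    exact ⟨∅, @isOpen_empty _ (projZariski n), Set.empty_subset _, by simp⟩
  have hprime := tupleIdeal_isPrime hX
  obtain ⟨b, hb, hbP⟩ := exists_notMem_tupleIdeal_isIdentifiable hX hJ hli
  obtain ⟨a, ha, haw⟩ := exists_eval_ne_zero_imp_exists_preimage (tupleIdeal X) (sumPolys k n) hb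
  obtain ⟨P, hP, hPa⟩ := notMem_tupleIdeal.mp ha
  rw [eval_aeval_sumPolys] at hPa
  -- The polynomial `a` need not be homogeneous. Where its component of degree `d` is nonzero, some
  -- multiple of the representative satisfies `a ≠ 0`, which is enough for a projective point.
  obtain ⟨d, hd⟩ := exists_eval_homogeneousComponent_ne_zero hPa
  have hhom := homogeneousComponent_isHomogeneous d a
  refine ⟨_, isOpen_setOf_eval_rep_ne_zero hhom,
    join_subset_closure_inter hX hhom ⟨P, hP, hd⟩, ?_⟩
  rintro y ⟨hyJ, hy⟩
  obtain ⟨c, hc, hca⟩ := exists_ne_zero_eval_smul_ne_zero hy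
  -- The preimage `x` is only known to satisfy `tupleIdeal X`; `b ≠ 0` at `x` puts it into the
  -- product of the cones.
  obtain ⟨x, hx, hxb, hxw⟩ := haw (c • y.rep) (fun f hf =>
    eval_smul_rep_eq_zero_of_mem_join (aeval_sumPolys_mem_tupleIdeal.mp hf) hyJ c) hca
  let R : Fin k → Vec n := fun i j => x (i, j)
  have hR : ∑ i, R i = c • y.rep := by
    rw [← eval_sumPolys]
    exact funext hxw
  have h0 : ∑ i, R i ≠ 0 := hR ▸ smul_ne_zero hc y.rep_nonzero
  have hmk : Projectivization.mk ℂ (∑ i, R i) h0 = y := by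
    rw [← y.mk_rep, Projectivization.mk_eq_mk_iff']
    exact ⟨c, hR.symm⟩
  rw [← hmk]
  exact (hbP R hx hxb).hasEssentiallyUniqueDecomposition h0
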